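/- Let $\lambda$ be a regular uncountable cardinal such that $\lambda^{<\lambda}=\lambda$ and $2^\lambda=\lambda^+$. Notation. For a set $C$ of ordinals let $\operatorname{acc}(C)=\{\alpha\in C\mid \sup(C\cap\alpha)=\alpha>0\}$ and $\operatorname{nacc}(C)=C\setminus\operatorname{acc}(C)$, and let $E^{\lambda^+}_{<\lambda}=\{\alpha<\lambda^+\mid \operatorname{cf}(\alpha)<\lambda\}$. For a cardinal $\mu$, call a sequence $\langle\mathcal C_\alpha\mid\alpha<\lambda^+\rangle$ *$\mu$-coherent* if for every (nonzero) limit ordinal $\alpha<\lambda^+$: $\mathcal C_\alpha$ is a nonempty collection of club (closed and cofinal) subsets of $\alpha$ with $|\mathcal C_\alpha|<\mu$; and $C\cap\bar\alpha\in\mathcal C_{\bar\alpha}$ for every $C\in\mathcal C_\alpha$ and $\bar\alpha\in\operatorname{acc}(C)$. A *$\square(\lambda^+,\lambda)$-sequence* is a $\lambda^+$-coherent sequence $\langle\mathcal C_\alpha\mid\alpha<\lambda^+\rangle$ such that for every club $D\subseteq\lambda^+$ there is $\alpha\in\operatorname{acc}(D)$ with $D\cap\alpha\notin\mathcal C_\alpha$.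 Theorem. Suppose that there exists a $\square(\lambda^+,\lambda)$-sequence $\langle\mathcal C_\alpha\mid\alpha<\lambda^+\rangle$ for which the set $\{\alpha\in E^{\lambda^+}_{<\lambda}\mid |\mathcal C_\alpha|<\lambda\}$ is stationary in $\lambda^+$. Then $\boxtimes^*(\lambda^+)$ holds; that is, there exists a $\lambda^+$-coherent sequence $\langle\mathcal D_\alpha\mid\alpha<\lambda^+\rangle$ such that for every cofinal $X\subseteq\lambda^+$ there is $\alpha\in\operatorname{acc}(\lambda^+)$ (that is, a nonzero limit ordinal $\alpha<\lambda^+$) with $\sup(\operatorname{nacc}(C)\cap X)=\alpha$ for all $C\in\mathcal D_\alpha$. -/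

import Mathlib

open Cardinal

universe u

namespace SquareBox

/-- `C` is a club subset of the ordinal `o`: a subset of `o = {ξ | ξ < o}` that is closed in `o`
and cofinal in `o`. -/
def IsClubIn (C : Set Ordinal.{u}) (o : Ordinal.{u}) : Prop :=
  C ⊆ Set.Iio o ∧ IsClub (Subtype.val ⁻¹' C : Set (Set.Iio o))

/-- `S ∩ o` is a stationary subset of the ordinal `o`: it meets every club subset of `o`. -/
def IsStationaryIn (S : Set Ordinal.{u}) (o : Ordinal.{u}) : Prop :=
  IsStationary (Subtype.val ⁻¹' S : Set (Set.Iio o))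

/-- `acc(C) = {α ∈ C | sup (C ∩ α) = α > 0}`. -/
def acc (C : Set Ordinal.{u}) : Set Ordinal.{u} :=
  {α | α ∈ C ∧ sSup (C ∩ Set.Iio α) = α ∧ 0 < α}

/-- `nacc(C) = C \ acc(C)`. -/
def nacc (C : Set Ordinal.{u}) : Set Ordinal.{u} :=
  C \ acc C

/-- `E^κ_{<lam} = {α < κ | cf(α) < lam}`. -/
def cofBelow (κ lam : Cardinal.{u}) : Set Ordinal.{u} :=
  {α | α < κ.ord ∧ α.cof < lam}

/-- For every limit ordinal `α < κ`, the collection `𝒞 α` is a nonempty collection of fewer than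
`μ` club subsets of `α`, and it is coherent: `C ∩ β ∈ 𝒞 β` for all `C ∈ 𝒞 α` and `β ∈ acc(C)`.
A sequence indexed by `κ` is a function on all ordinals of which only the values below `κ` are
used. Sets of ordinals live one universe up, whence the `lift`. -/
def IsCoherentClubSeq (κ μ : Cardinal.{u}) (𝒞 : Ordinal.{u} → Set (Set Ordinal.{u})) : Prop :=
  ∀ α < κ.ord, Order.IsSuccLimit α →
    ((𝒞 α).Nonempty ∧ (∀ C ∈ 𝒞 α, IsClubIn C α) ∧ #(𝒞 α) < Cardinal.lift.{u + 1} μ) ∧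
    ∀ C ∈ 𝒞 α, ∀ β ∈ acc C, C ∩ Set.Iio β ∈ 𝒞 β

/-- `𝒞` is a `□(κ, <μ)`-sequence. -/
def IsSquareLTSeq (κ μ : Cardinal.{u}) (𝒞 : Ordinal.{u} → Set (Set Ordinal.{u})) : Prop :=
  IsCoherentClubSeq κ μ 𝒞 ∧
  ∀ D : Set Ordinal.{u}, IsClubIn D κ.ord → ∃ α ∈ acc D, D ∩ Set.Iio α ∉ 𝒞 α

/-- `𝒞` is a `□(κ, μ)`-sequence, that is, a `□(κ, <μ⁺)`-sequence. -/
def IsSquareSeq (κ μ : Cardinal.{u}) (𝒞 : Ordinal.{u} → Set (Set Ordinal.{u})) : Prop :=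
  IsSquareLTSeq κ (Order.succ μ) 𝒞

/-- The principle `⊠*(κ)`. -/
def BoxTimesStar (κ : Cardinal.{u}) : Prop :=
  ∃ 𝒞 : Ordinal.{u} → Set (Set Ordinal.{u}),
    IsCoherentClubSeq κ κ 𝒞 ∧
    ∀ X : Set Ordinal.{u}, X ⊆ Set.Iio κ.ord → (∀ β < κ.ord, ∃ ξ ∈ X, β ≤ ξ) →
      ∃ α ∈ acc (Set.Iio κ.ord), ∀ C ∈ 𝒞 α, sSup (nacc C ∩ X) = α

end SquareBox

/-! Suppose `⊠*(λ⁺)` fails. Moving each non-accumulation point β of C within (sup(C ∩ β), β]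
preserves accumulation points and coherence (`IsCoherentClubSeq.shift`), so every rule for these
moves gives a coherent sequence that fails at some cofinal set. Recursively let X_i be such a
failure for the rule that tries to hit X_i using only the X_k with k < i.

The rule rests on 2^λ = λ⁺: guesses at initial parts of λ-sequences of sets are listed in type λ⁺,
hence those below β in type λ. At stage i it trusts the first guess not refuted by X_k, k < i. If a
guess listed below β is right about all of X, regularity of λ gives one stage refuting every wrong
guess before it, and from then on the rule hits X_i (`exists_forall_predict_mem`). Such a guess
exists once the gap below β is long (`exists_fits`).

Long gaps occur cofinally in every member of some narrow level α of cofinality below λ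
(`IsSquareLTSeq.exists_large_gaps`). Otherwise members of narrow levels contain final segments of a
fixed club; they form a tree with narrow levels, whose cofinal branch (`IsSetTree.exists_branch`)
threads the square sequence. At this α fewer than λ pairs of a member and a bound matter, so one
stage i < λ works for all of them, contradicting the choice of X_i. -/

namespace SquareBox

/-! ### Limit points and clubs in order-theoretic terms -/

/-- `β` is a positive limit of elements of `C` below `β`. -/
def IsLim (C : Set Ordinal.{u}) (β : Ordinal.{u}) : Prop :=
  0 < β ∧ ∀ ξ < β, ∃ γ ∈ C, ξ < γ ∧ γ < β

theorem bddAbove_inter_Iio (C : Set Ordinal.{u}) (β : Ordinal.{u}) : BddAbove (C ∩ Set.Iio β) :=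
  ⟨β, fun _ hx => le_of_lt hx.2⟩

theorem sSup_inter_Iio_le (C : Set Ordinal.{u}) (β : Ordinal.{u}) : sSup (C ∩ Set.Iio β) ≤ β :=
  csSup_le' fun _ hx => le_of_lt hx.2

theorem le_sSup_inter_Iio {C : Set Ordinal.{u}} {β γ : Ordinal.{u}} (h : γ ∈ C) (hlt : γ < β) :
    γ ≤ sSup (C ∩ Set.Iio β) :=
  le_csSup (bddAbove_inter_Iio C β) ⟨h, hlt⟩

theorem sSup_inter_Iio_eq_iff {C : Set Ordinal.{u}} {β : Ordinal.{u}} (h0 : 0 < β) :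
    sSup (C ∩ Set.Iio β) = β ↔ IsLim C β := by
  constructor
  · intro h
    refine ⟨h0, fun ξ hξ => ?_⟩
    rw [← h] at hξ
    obtain ⟨γ, hγ, hlt⟩ := exists_lt_of_lt_csSup' hξ
    exact ⟨γ, hγ.1, hlt, hγ.2⟩
  · rintro ⟨-, h⟩
    refine le_antisymm (sSup_inter_Iio_le C β) (le_of_forall_lt fun ξ hξ => ?_)
    obtain ⟨γ, hγ, h1, h2⟩ := h ξ hξ
    exact h1.trans_le (le_sSup_inter_Iio hγ h2)

theorem mem_acc_iff {C : Set Ordinal.{u}} {β : Ordinal.{u}} : β ∈ acc C ↔ β ∈ C ∧ IsLim C β := by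
  constructor
  · rintro ⟨h1, h2, h3⟩
    exact ⟨h1, (sSup_inter_Iio_eq_iff h3).1 h2⟩
  · rintro ⟨h1, h2⟩
    exact ⟨h1, (sSup_inter_Iio_eq_iff h2.1).2 h2, h2.1⟩

theorem mem_nacc_iff {C : Set Ordinal.{u}} {β : Ordinal.{u}} :
    β ∈ nacc C ↔ β ∈ C ∧ ¬ IsLim C β := by
  rw [nacc, Set.mem_sdiff, mem_acc_iff]
  tauto

theorem sSup_inter_Iio_lt {C : Set Ordinal.{u}} {β : Ordinal.{u}} (h : ¬ IsLim C β) (h0 : 0 < β) :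
    sSup (C ∩ Set.Iio β) < β :=
  lt_of_le_of_ne (sSup_inter_Iio_le C β) fun he => h ((sSup_inter_Iio_eq_iff h0).1 he)

theorem IsLim.mono {C D : Set Ordinal.{u}} {β : Ordinal.{u}} (h : IsLim C β)
    (hCD : C ∩ Set.Iio β ⊆ D) : IsLim D β :=
  ⟨h.1, fun ξ hξ => by
    obtain ⟨γ, hγ, h1, h2⟩ := h.2 ξ hξ
    exact ⟨γ, hCD ⟨hγ, h2⟩, h1, h2⟩⟩

theorem IsLim.isSuccLimit {C : Set Ordinal.{u}} {β : Ordinal.{u}} (h : IsLim C β) :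
    Order.IsSuccLimit β := by
  rw [Order.isSuccLimit_iff]
  refine ⟨by simpa using h.1.ne', Order.isSuccPrelimit_of_succ_lt fun a ha => ?_⟩
  obtain ⟨γ, -, h1, h2⟩ := h.2 a ha
  exact (Order.succ_le_of_lt h1).trans_lt h2

theorem isClubIn_iff {C : Set Ordinal.{u}} {α : Ordinal.{u}} :
    IsClubIn C α ↔ C ⊆ Set.Iio α ∧ (∀ ξ < α, ∃ γ ∈ C, ξ ≤ γ) ∧ ∀ β < α, IsLim C β → β ∈ C := by
  constructor
  · rintro ⟨hs, hc⟩
    refine ⟨hs, fun ξ hξ => ?_, fun β hβ hl => ?_⟩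
    · obtain ⟨γ, h1, h2⟩ := hc.isCofinal ⟨ξ, hξ⟩
      exact ⟨γ.1, h1, h2⟩
    · refine hc.isLUB_mem (α := Set.Iio α) (t := Subtype.val ⁻¹' (C ∩ Set.Iio β)) (x := ⟨β, hβ⟩)
        (fun x hx => hx.1) ?_ ⟨?_, ?_⟩
      · obtain ⟨γ, h1, -, h2⟩ := hl.2 0 hl.1
        exact ⟨⟨γ, h2.trans hβ⟩, h1, h2⟩
      · exact fun x hx => le_of_lt hx.2
      · intro b hb
        refine le_of_not_gt fun hlt => ?_
        obtain ⟨γ, h1, h2, h3⟩ := hl.2 b.1 hlt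
        exact (hb (show (⟨γ, h3.trans hβ⟩ : Set.Iio α) ∈ _ from ⟨h1, h3⟩)).not_gt h2
  · rintro ⟨hs, hu, hc⟩
    refine ⟨hs, ⟨?_, fun x => ?_⟩⟩
    · intro t ht hne _ x hx
      by_cases hxt : x ∈ t
      · exact ht hxt
      refine hc x.1 x.2 ⟨?_, fun ξ hξ => ?_⟩
      · obtain ⟨y, hy⟩ := hne
        have : y < x := lt_of_le_of_ne (hx.1 hy) fun h => hxt (h ▸ hy)
        exact (zero_le (a := y.1)).trans_lt this
      · by_contra! hcon
        have : x ≤ ⟨ξ, hξ.trans x.2⟩ := hx.2 fun y hy => by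
          by_contra hlt
          have h1 : ξ < y.1 := not_le.1 hlt
          have h2 : x.1 ≤ y.1 := hcon y.1 (ht hy) h1
          have h3 : y = x := le_antisymm (hx.1 hy) h2
          exact hxt (h3 ▸ hy)
        exact (not_lt.2 this) hξ
    · obtain ⟨γ, h1, h2⟩ := hu x.1 x.2
      exact ⟨⟨γ, hs h1⟩, h1, h2⟩

theorem IsClubIn.exists_gt {C : Set Ordinal.{u}} {α ξ : Ordinal.{u}} (h : IsClubIn C α)
    (hα : Order.IsSuccLimit α) (hξ : ξ < α) : ∃ γ ∈ C, ξ < γ ∧ γ < α := by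
  obtain ⟨γ, h1, h2⟩ := (isClubIn_iff.1 h).2.1 _ (hα.succ_lt hξ)
  exact ⟨γ, h1, Order.succ_le_iff.1 h2, h.1 h1⟩

/-! ### Bounds and closure points below a regular cardinal -/

/-- Fewer than `c` ordinals below the regular cardinal `c` have a common bound below `c`. -/
theorem exists_bound {c : Cardinal.{u}} (hc : c.IsRegular) {ι : Type (u + 1)}
    (hι : #ι < Cardinal.lift.{u + 1} c) (f : ι → Ordinal.{u}) (hf : ∀ i, f i < c.ord) :
    ∃ b < c.ord, ∀ i, f i < b := by
  have hlim : Order.IsSuccLimit c.ord := Cardinal.isSuccLimit_ord hc.aleph0_le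
  have hsmall : Small.{u} ι := by
    rw [Cardinal.small_iff_lift_mk_lt_univ]
    simpa using hι.trans (Cardinal.lift_lt_univ' c)
  have : ⨆ i, f i < c.ord := by
    apply Ordinal.lift_iSup_lt_of_lt_cof _ hf
    rw [← Ordinal.lift_cof, hc.cof_ord, Cardinal.lift_id'.{u, u + 1} #ι]
    exact hι
  exact ⟨_, hlim.succ_lt this, fun i => Order.lt_succ_of_le (le_ciSup (Ordinal.bddAbove_of_small) i)⟩

theorem exists_bound_Iio {c : Cardinal.{u}} (hc : c.IsRegular) {β : Ordinal.{u}} (hβ : β < c.ord)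
    (f : Ordinal.{u} → Ordinal.{u}) (hf : ∀ ξ < β, f ξ < c.ord) :
    ∃ b < c.ord, ∀ ξ < β, f ξ < b := by
  obtain ⟨b, h1, h2⟩ := exists_bound hc (ι := Set.Iio β)
    (by rw [Cardinal.mk_Iio_ordinal]; exact Cardinal.lift_lt.2 (Cardinal.lt_ord.1 hβ))
    (fun ξ => f ξ.1) (fun ξ => hf ξ.1 ξ.2)
  exact ⟨b, h1, fun ξ hξ => h2 ⟨ξ, hξ⟩⟩

/-- The positive ordinals below `κ` closed under `g`. -/
def closurePoints (κ : Ordinal.{u}) (g : Ordinal.{u} → Ordinal.{u}) : Set Ordinal.{u} :=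
  {γ | γ < κ ∧ 0 < γ ∧ ∀ ξ < γ, g ξ < γ}

theorem isClubIn_closurePoints {c : Cardinal.{u}} (hc : c.IsRegular) (hunc : ℵ₀ < c)
    {g : Ordinal.{u} → Ordinal.{u}} (hg : ∀ ξ < c.ord, g ξ < c.ord) :
    IsClubIn (closurePoints c.ord g) c.ord := by
  rw [isClubIn_iff]
  have hlim : Order.IsSuccLimit c.ord := Cardinal.isSuccLimit_ord hc.aleph0_le
  refine ⟨fun x hx => hx.1, fun ξ hξ => ?_, fun β hβ hl => ⟨hβ, hl.1, fun ξ hξ => ?_⟩⟩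
  · have step : ∀ ξ, ∃ b, ξ < c.ord → b < c.ord ∧ ξ < b ∧ ∀ η < ξ, g η < b := by
      intro ξ
      by_cases hξ : ξ < c.ord
      · obtain ⟨b, h1, h2⟩ := exists_bound_Iio hc hξ g fun η hη => hg η (hη.trans hξ)
        exact ⟨max b (Order.succ ξ), fun _ => ⟨max_lt h1 (hlim.succ_lt hξ),
          lt_max_of_lt_right (Order.lt_succ ξ), fun η hη => lt_max_of_lt_left (h2 η hη)⟩⟩
      -- A junk value at ordinals outside the range, so that `choose` yields a total function; the
      -- same device recurs below.
      · exact ⟨0, fun h => absurd h hξ⟩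
    choose h hh using step
    let a : ℕ → Ordinal.{u} := fun n => h^[n] ξ
    have ha : ∀ n, a n < c.ord := by
      intro n
      induction n with
      | zero => exact hξ
      | succ n ih => simpa only [a, Function.iterate_succ_apply'] using (hh _ ih).1
    have hs : ∀ n, a n < a (n + 1) ∧ ∀ η < a n, g η < a (n + 1) := by
      intro n
      have := (hh _ (ha n)).2
      simpa only [a, Function.iterate_succ_apply'] using this
    -- Uncountability keeps the supremum of the ω iterates below `c`.
    obtain ⟨b, hb, hab⟩ := exists_bound hc (ι := ULift.{u + 1} ℕ)
      (by simpa using Cardinal.lift_lt.{u, u + 1}.2 hunc) (fun n => a n.down) (fun n => ha n.down)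
    have hbdd : BddAbove (Set.range a) := ⟨b, by
      rintro _ ⟨n, rfl⟩
      exact (hab ⟨n⟩).le⟩
    refine ⟨⨆ n, a n, ⟨?_, ?_, ?_⟩, le_ciSup hbdd 0⟩
    · exact (ciSup_le' fun n => (hab ⟨n⟩).le).trans_lt hb
    · exact (zero_le (a := a 0)).trans_lt ((hs 0).1.trans_le (le_ciSup hbdd 1))
    · intro η hη
      obtain ⟨n, hn⟩ := exists_lt_of_lt_ciSup' hη
      exact ((hs n).2 η hn).trans_le (le_ciSup hbdd (n + 1))
  · obtain ⟨γ, h1, h2, h3⟩ := hl.2 ξ hξ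
    exact (h1.2.2 ξ h2).trans h3

theorem IsStationaryIn.exists_closed {c : Cardinal.{u}} (hc : c.IsRegular) (hunc : ℵ₀ < c)
    {S : Set Ordinal.{u}} (hS : IsStationaryIn S c.ord) {g : Ordinal.{u} → Ordinal.{u}}
    (hg : ∀ ξ < c.ord, g ξ < c.ord) : ∃ α ∈ S, α ∈ closurePoints c.ord g := by
  obtain ⟨x, h1, h2⟩ := hS (isClubIn_closurePoints hc hunc hg).2
  exact ⟨x.1, h1, h2⟩

/-! ### Moving non-accumulation points inside their gaps -/

/-- `p δ β` lies in `(δ, β]` for all `δ < β`. -/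
def IsSelector (p : Ordinal.{u} → Ordinal.{u} → Ordinal.{u}) : Prop :=
  ∀ δ β, p δ β ≤ β ∧ (δ < β → δ < p δ β)

open Classical in
/-- Non-accumulation points `β` of `C` are moved to `p (sup (C ∩ β)) β`, the others stay. -/
noncomputable def shift (p : Ordinal.{u} → Ordinal.{u} → Ordinal.{u}) (C : Set Ordinal.{u})
    (β : Ordinal.{u}) : Ordinal.{u} :=
  if IsLim C β then β else p (sSup (C ∩ Set.Iio β)) β

section shift

variable {p : Ordinal.{u} → Ordinal.{u} → Ordinal.{u}} {C : Set Ordinal.{u}} {α β γ : Ordinal.{u}}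

theorem shift_of_isLim (h : IsLim C β) : shift p C β = β := if_pos h

theorem shift_of_not_isLim (h : ¬ IsLim C β) : shift p C β = p (sSup (C ∩ Set.Iio β)) β := if_neg h

theorem shift_le (hp : IsSelector p) (C : Set Ordinal.{u}) (β : Ordinal.{u}) :
    shift p C β ≤ β := by
  unfold shift
  split_ifs
  exacts [le_rfl, (hp _ _).1]

theorem lt_shift (hp : IsSelector p) (hγ : γ ∈ C) (hlt : γ < β) : γ < shift p C β := by
  unfold shift
  split_ifs with h
  · exact hlt
  · exact (le_sSup_inter_Iio hγ hlt).trans_lt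
      ((hp _ _).2 (sSup_inter_Iio_lt h ((zero_le (a := γ)).trans_lt hlt)))

/-- The points interleave: γ < γ' in C gives γ < `shift p C γ'` ≤ γ'. -/
theorem isLim_image_shift (hp : IsSelector p) : IsLim (shift p C '' C) β ↔ IsLim C β := by
  constructor
  · rintro ⟨h0, h⟩
    refine ⟨h0, fun ξ hξ => ?_⟩
    obtain ⟨_, ⟨γ, hγ, rfl⟩, h1, h2⟩ := h ξ hξ
    obtain ⟨_, ⟨γ', hγ', rfl⟩, h3, h4⟩ := h _ h2
    have hlt : γ < γ' := by
      by_contra! hle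
      rcases hle.eq_or_lt with rfl | hlt
      · exact h3.false
      · exact (h3.trans_le (shift_le hp C γ')).not_gt (lt_shift hp hγ' hlt)
    exact ⟨γ, hγ, h1.trans_le (shift_le hp C γ), (lt_shift hp hγ hlt).trans h4⟩
  · rintro ⟨h0, h⟩
    refine ⟨h0, fun ξ hξ => ?_⟩
    obtain ⟨γ, hγ, h1, h2⟩ := h ξ hξ
    obtain ⟨γ', hγ', h3, h4⟩ := h γ h2
    exact ⟨_, ⟨γ', hγ', rfl⟩, h1.trans (lt_shift hp hγ h3), (shift_le hp C γ').trans_lt h4⟩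

theorem isClubIn_image_shift (hp : IsSelector p) (hα : Order.IsSuccLimit α) (hC : IsClubIn C α) :
    IsClubIn (shift p C '' C) α := by
  obtain ⟨h1, -, h3⟩ := isClubIn_iff.1 hC
  refine isClubIn_iff.2 ⟨?_, fun ξ hξ => ?_, fun β hβ hl => ?_⟩
  · rintro _ ⟨β, hβ, rfl⟩
    exact (shift_le hp C β).trans_lt (h1 hβ)
  · obtain ⟨γ, hγ, hξγ, hγα⟩ := hC.exists_gt hα hξ
    obtain ⟨γ', hγ', hlt, -⟩ := hC.exists_gt hα hγα
    exact ⟨_, ⟨γ', hγ', rfl⟩, (hξγ.trans (lt_shift hp hγ hlt)).le⟩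
  · rw [isLim_image_shift hp] at hl
    exact ⟨β, h3 β hβ hl, shift_of_isLim hl⟩

theorem acc_image_shift (hp : IsSelector p) (hC : IsClubIn C α) :
    acc (shift p C '' C) = acc C := by
  obtain ⟨h1, -, h3⟩ := isClubIn_iff.1 hC
  ext β
  rw [mem_acc_iff, mem_acc_iff, isLim_image_shift hp]
  refine and_congr_left fun hl => ⟨?_, fun h => ⟨β, h, shift_of_isLim hl⟩⟩
  rintro ⟨γ, hγ, rfl⟩
  exact h3 _ ((shift_le hp C γ).trans_lt (h1 hγ)) hl

/-- The moved point still lies above sup(C ∩ β), and limits of the image are limits of C, none of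
which lies in the gap. -/
theorem shift_mem_nacc (hp : IsSelector p) (hβ : β ∈ nacc C) :
    shift p C β ∈ nacc (shift p C '' C) := by
  obtain ⟨h1, h2⟩ := mem_nacc_iff.1 hβ
  refine mem_nacc_iff.2 ⟨⟨β, h1, rfl⟩, fun h => ?_⟩
  rw [isLim_image_shift hp] at h
  have h0 : 0 < β := h.1.trans_le (shift_le hp C β)
  have hlt : sSup (C ∩ Set.Iio β) < shift p C β := by
    rw [shift_of_not_isLim h2]
    exact (hp _ _).2 (sSup_inter_Iio_lt h2 h0)
  obtain ⟨γ, hγ, h3, h4⟩ := h.2 _ hlt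
  exact h3.not_ge (le_sSup_inter_Iio hγ (h4.trans_le (shift_le hp C β)))

theorem isLim_inter_Iio (h : γ ≤ β) : IsLim (C ∩ Set.Iio β) γ ↔ IsLim C γ :=
  ⟨fun hl => hl.mono fun _ hx => hx.1.1, fun hl => hl.mono fun _ hx => ⟨hx.1, hx.2.trans_le h⟩⟩

theorem shift_inter_Iio (h : γ ≤ β) : shift p (C ∩ Set.Iio β) γ = shift p C γ := by
  unfold shift
  rw [isLim_inter_Iio h, Set.inter_assoc, Set.Iio_inter_Iio, min_eq_right h]

/-- The shift at γ depends only on C ∩ γ, and the accumulation point β is fixed, so truncation at β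
commutes with shifting. -/
theorem image_shift_inter_Iio (hp : IsSelector p) (hβ : β ∈ acc C) :
    shift p C '' C ∩ Set.Iio β = shift p (C ∩ Set.Iio β) '' (C ∩ Set.Iio β) := by
  obtain ⟨h1, h2⟩ := mem_acc_iff.1 hβ
  ext y
  constructor
  · rintro ⟨⟨γ, hγ, rfl⟩, hlt⟩
    have hγβ : γ < β := by
      by_contra! hle
      rcases hle.eq_or_lt with rfl | hlt'
      · exact absurd (shift_of_isLim h2 (p := p)) (ne_of_lt hlt)
      · exact (lt_shift hp h1 hlt').not_gt hlt
    exact ⟨γ, ⟨hγ, hγβ⟩, shift_inter_Iio hγβ.le⟩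
  · rintro ⟨γ, ⟨hγ, hγβ⟩, rfl⟩
    rw [shift_inter_Iio (le_of_lt hγβ)]
    exact ⟨⟨γ, hγ, rfl⟩, (shift_le hp C γ).trans_lt hγβ⟩

end shift

theorem IsCoherentClubSeq.shift {κ μ : Cardinal.{u}} {𝒞 : Ordinal.{u} → Set (Set Ordinal.{u})}
    (h : IsCoherentClubSeq κ μ 𝒞) {p : Ordinal.{u} → Ordinal.{u} → Ordinal.{u}}
    (hp : IsSelector p) : IsCoherentClubSeq κ μ fun α => (fun C => shift p C '' C) '' 𝒞 α := by
  intro α hα hlim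
  obtain ⟨⟨h1, h2, h3⟩, h4⟩ := h α hα hlim
  refine ⟨⟨h1.image _, ?_, mk_image_le.trans_lt h3⟩, ?_⟩
  · rintro _ ⟨C, hC, rfl⟩
    exact isClubIn_image_shift hp hlim (h2 C hC)
  · rintro _ ⟨C, hC, rfl⟩ β hβ
    rw [acc_image_shift hp (h2 C hC)] at hβ
    exact ⟨_, h4 C hC β hβ, (image_shift_inter_Iio hp hβ).symm⟩

theorem inter_Iio_inter_Iio_of_le (C : Set Ordinal.{u}) {β γ : Ordinal.{u}} (h : γ ≤ β) :
    C ∩ Set.Iio β ∩ Set.Iio γ = C ∩ Set.Iio γ := by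
  rw [Set.inter_assoc, Set.Iio_inter_Iio, min_eq_right h]

/-! ### Cofinal branches through trees with narrow levels -/

/-- `T` assigns to every level `γ ∈ A` a nonempty collection of fewer than `κ` subsets of `γ`,
closed under restriction to lower levels. -/
structure IsSetTree (κ : Cardinal.{u}) (A : Set Ordinal.{u})
    (T : Ordinal.{u} → Set (Set Ordinal.{u})) : Prop where
  lt : ∀ γ ∈ A, γ < κ.ord
  unbounded : ∀ ξ < κ.ord, ∃ γ ∈ A, ξ ≤ γ
  subset : ∀ γ ∈ A, ∀ C ∈ T γ, C ⊆ Set.Iio γ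
  restrict : ∀ α ∈ A, ∀ γ ∈ A, γ < α → ∀ C ∈ T α, C ∩ Set.Iio γ ∈ T γ
  card_lt : ∀ γ ∈ A, #(T γ) < Cardinal.lift.{u + 1} κ
  nonempty : ∀ γ ∈ A, (T γ).Nonempty

/-- The nodes of `T` having extensions on all higher levels. -/
def pruned (A : Set Ordinal.{u}) (T : Ordinal.{u} → Set (Set Ordinal.{u})) (γ : Ordinal.{u}) :
    Set (Set Ordinal.{u}) :=
  {C | C ∈ T γ ∧ ∀ α ∈ A, γ < α → ∃ D ∈ T α, D ∩ Set.Iio γ = C}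

namespace IsSetTree

variable {κ : Cardinal.{u}} {A : Set Ordinal.{u}} {T : Ordinal.{u} → Set (Set Ordinal.{u})}
  {α γ : Ordinal.{u}} {C D : Set Ordinal.{u}}

/-- If every candidate node died, regularity would bound the levels of death of the fewer than κ
nodes at γ; a node above that bound restricting into `P` is a contradiction. -/
theorem exists_mem_pruned (h : IsSetTree κ A T) (hκ : κ.IsRegular) (hγ : γ ∈ A)
    (P : Set (Set Ordinal.{u})) (hP : ∀ α ∈ A, γ < α → ∃ D ∈ T α, D ∩ Set.Iio γ ∈ P) :
    ∃ C ∈ pruned A T γ, C ∈ P := by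
  by_contra! hcon
  have hb : ∀ C : T γ, ∃ b < κ.ord, C.1 ∈ P →
      b ∈ A ∧ γ < b ∧ ∀ D ∈ T b, D ∩ Set.Iio γ ≠ C.1 := by
    rintro ⟨C, hC⟩
    by_cases hCP : C ∈ P
    · by_contra! hno
      refine hcon C ⟨hC, fun α hα hlt => ?_⟩ hCP
      obtain ⟨-, h2⟩ := hno α (h.lt α hα)
      exact h2 hα hlt
    · exact ⟨γ, h.lt γ hγ, fun h => absurd h hCP⟩
  choose b hb1 hb2 using hb
  obtain ⟨m, hm, hbm⟩ := exists_bound hκ (h.card_lt γ hγ) b hb1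
  have hlim : Order.IsSuccLimit κ.ord := Cardinal.isSuccLimit_ord hκ.aleph0_le
  obtain ⟨α, hα, hle⟩ := h.unbounded (max m (Order.succ γ))
    (max_lt hm (hlim.succ_lt (h.lt γ hγ)))
  have hγα : γ < α := Order.succ_le_iff.1 ((le_max_right _ _).trans hle)
  obtain ⟨D, hD, hDP⟩ := hP α hα hγα
  obtain ⟨h1, h2, h3⟩ := hb2 ⟨_, h.restrict α hα γ hγ hγα D hD⟩ hDP
  exact h3 _ (h.restrict α hα _ h1 ((hbm _).trans_le ((le_max_left _ _).trans hle)) D hD)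
    (inter_Iio_inter_Iio_of_le D h2.le)

theorem pruned_restrict (h : IsSetTree κ A T) (hα : α ∈ A) (hγ : γ ∈ A) (hlt : γ < α)
    (hD : D ∈ pruned A T α) : D ∩ Set.Iio γ ∈ pruned A T γ := by
  refine ⟨h.restrict α hα γ hγ hlt D hD.1, fun β hβ hγβ => ?_⟩
  rcases lt_trichotomy β α with hβα | rfl | hαβ
  · exact ⟨_, h.restrict α hα β hβ hβα D hD.1, inter_Iio_inter_Iio_of_le D hγβ.le⟩
  · exact ⟨D, hD.1, rfl⟩
  · obtain ⟨F, hF, rfl⟩ := hD.2 β hβ hαβ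
    exact ⟨F, hF, (inter_Iio_inter_Iio_of_le F hlt.le).symm⟩

theorem pruned_extend (h : IsSetTree κ A T) (hκ : κ.IsRegular) (hα : α ∈ A)
    (hlt : γ < α) (hC : C ∈ pruned A T γ) : ∃ D ∈ pruned A T α, D ∩ Set.Iio γ = C := by
  refine h.exists_mem_pruned hκ hα {D | D ∩ Set.Iio γ = C} fun β hβ hαβ => ?_
  obtain ⟨F, hF, hFC⟩ := hC.2 β hβ (hlt.trans hαβ)
  exact ⟨F, hF, (inter_Iio_inter_Iio_of_le F hlt.le).trans hFC⟩

theorem pruned_nonempty (h : IsSetTree κ A T) (hκ : κ.IsRegular) (hα : α ∈ A) :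
    (pruned A T α).Nonempty := by
  obtain ⟨C, hC, -⟩ := h.exists_mem_pruned hκ hα Set.univ fun β hβ _ => by
    obtain ⟨F, hF⟩ := h.nonempty β hβ
    exact ⟨F, hF, trivial⟩
  exact ⟨C, hC⟩

/-- Pruned nodes extend to a narrow level above, and distinct nodes have distinct extensions. -/
theorem mk_pruned_lt (h : IsSetTree κ A T) (hκ : κ.IsRegular) {μ : Cardinal.{u + 1}}
    (hμ : ∀ ξ < κ.ord, ∃ γ ∈ A, ξ ≤ γ ∧ #(T γ) < μ) (hγ : γ ∈ A) : #(pruned A T γ) < μ := by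
  have hlim : Order.IsSuccLimit κ.ord := Cardinal.isSuccLimit_ord hκ.aleph0_le
  obtain ⟨α, hα, hle, hlt⟩ := hμ _ (hlim.succ_lt (h.lt γ hγ))
  refine lt_of_le_of_lt ?_ hlt
  choose f hf1 hf2 using fun C : pruned A T γ => C.2.2 α hα (Order.succ_le_iff.1 hle)
  refine mk_le_of_injective (f := fun C => (⟨f C, hf1 C⟩ : T α)) fun C D hCD => ?_
  have : f C = f D := congrArg Subtype.val hCD
  exact Subtype.ext (by rw [← hf2 C, ← hf2 D, this])

/-- A pruned node that never splits in the pruned tree has one pruned extension per level; their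
union is the branch. -/
theorem exists_branch_of_unique (h : IsSetTree κ A T) (hκ : κ.IsRegular)
    (hγ : γ ∈ A) (hC : C ∈ pruned A T γ)
    (huniq : ∀ α ∈ A, γ < α → ∀ D ∈ pruned A T α, ∀ D' ∈ pruned A T α,
      D ∩ Set.Iio γ = C → D' ∩ Set.Iio γ = C → D = D') :
    ∃ U ⊆ Set.Iio κ.ord, ∀ α ∈ A, U ∩ Set.Iio α ∈ T α := by
  have hlim : Order.IsSuccLimit κ.ord := Cardinal.isSuccLimit_ord hκ.aleph0_le
  let U : Set Ordinal.{u} :=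
    {x | ∃ α ∈ A, γ < α ∧ ∃ D ∈ pruned A T α, D ∩ Set.Iio γ = C ∧ x ∈ D}
  have key : ∀ α ∈ A, γ < α → ∀ D ∈ pruned A T α, D ∩ Set.Iio γ = C → U ∩ Set.Iio α = D := by
    intro α hα hγα D hD hDC
    ext x
    constructor
    · rintro ⟨⟨β, hβ, hγβ, F, hF, hFC, hxF⟩, hxα⟩
      rcases lt_trichotomy β α with hlt | rfl | hlt
      · have : F = D ∩ Set.Iio β := huniq β hβ hγβ F hF _ (h.pruned_restrict hα hβ hlt hD) hFC
          ((inter_Iio_inter_Iio_of_le D hγβ.le).trans hDC)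
        rw [this] at hxF
        exact hxF.1
      · rwa [huniq β hβ hγβ D hD F hF hDC hFC]
      · rw [huniq α hα hγα D hD _ (h.pruned_restrict hβ hα hlt hF) hDC
          ((inter_Iio_inter_Iio_of_le F hγα.le).trans hFC)]
        exact ⟨hxF, hxα⟩
    · intro hx
      exact ⟨⟨α, hα, hγα, D, hD, hDC, hx⟩, h.subset α hα D hD.1 hx⟩
  refine ⟨U, ?_, fun α hα => ?_⟩
  · rintro x ⟨α, hα, -, D, hD, -, hx⟩
    exact (h.subset α hα D hD.1 hx).trans (h.lt α hα)
  · obtain ⟨β, hβ, hle⟩ := h.unbounded (max (Order.succ α) (Order.succ γ))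
      (max_lt (hlim.succ_lt (h.lt α hα)) (hlim.succ_lt (h.lt γ hγ)))
    have h1 : α < β := Order.succ_le_iff.1 ((le_max_left _ _).trans hle)
    have h2 : γ < β := Order.succ_le_iff.1 ((le_max_right _ _).trans hle)
    obtain ⟨D, hD, hDC⟩ := h.pruned_extend hκ hβ h2 hC
    rw [← inter_Iio_inter_Iio_of_le U h1.le, key β hβ h2 D hD hDC]
    exact h.restrict β hβ α hα h1 D hD.1

/-- A tree of height a regular uncountable `κ` with unboundedly many levels of size less than a
fixed `lam < κ` has a cofinal branch. -/
theorem exists_branch (h : IsSetTree κ A T) (hκ : κ.IsRegular) (hunc : ℵ₀ < κ)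
    {lam : Cardinal.{u}} (hlam : lam < κ)
    (hlev : ∀ ξ < κ.ord, ∃ γ ∈ A, ξ ≤ γ ∧ #(T γ) < Cardinal.lift.{u + 1} lam) :
    ∃ U ⊆ Set.Iio κ.ord, ∀ α ∈ A, U ∩ Set.Iio α ∈ T α := by
  by_contra hno
  have hsplit : ∀ γ ∈ A, ∀ C ∈ pruned A T γ, ∃ α ∈ A, γ < α ∧ ∃ D ∈ pruned A T α,
      ∃ D' ∈ pruned A T α, D ∩ Set.Iio γ = C ∧ D' ∩ Set.Iio γ = C ∧ D ≠ D' := by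
    intro γ hγ C hC
    by_contra! hcon
    exact hno (h.exists_branch_of_unique hκ hγ hC hcon)
  have hstep : ∀ ξ, ∃ b, ξ < κ.ord → b < κ.ord ∧ ∃ γ ∈ A, ξ ≤ γ ∧ γ < b ∧
      ∀ C ∈ pruned A T γ, ∃ α ∈ A, γ < α ∧ α < b ∧ ∃ D ∈ pruned A T α,
      ∃ D' ∈ pruned A T α, D ∩ Set.Iio γ = C ∧ D' ∩ Set.Iio γ = C ∧ D ≠ D' := by
    intro ξ
    by_cases hξ : ξ < κ.ord
    · obtain ⟨γ, hγ, hle⟩ := h.unbounded ξ hξ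
      choose s hs1 hs2 using fun C : pruned A T γ => hsplit γ hγ C.1 C.2
      obtain ⟨b, hb, hsb⟩ := exists_bound hκ
        ((mk_le_mk_of_subset fun C hC => hC.1).trans_lt (h.card_lt γ hγ)) s
        fun C => h.lt _ (hs1 C)
      refine ⟨b, fun _ => ⟨hb, γ, hγ, hle, ?_, fun C hC =>
        ⟨s ⟨C, hC⟩, hs1 _, (hs2 _).1, hsb _, (hs2 _).2⟩⟩⟩
      obtain ⟨C, hC⟩ := h.pruned_nonempty hκ hγ
      exact (hs2 ⟨C, hC⟩).1.trans (hsb _)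
    · exact ⟨0, fun h => absurd h hξ⟩
  choose g hg using hstep
  -- Between consecutive closure points of `g` every pruned node at some level splits.
  have hE := isClubIn_closurePoints hκ hunc (g := g) fun ξ hξ => (hg ξ hξ).1
  set E := closurePoints κ.ord g
  have hcard : Cardinal.lift.{u + 1} lam ≤ #E := by
    by_contra! hlt
    obtain ⟨b, hb, hEb⟩ := exists_bound hκ (hlt.trans (Cardinal.lift_lt.2 hlam))
      (fun x : E => x.1) fun x => hE.1 x.2
    obtain ⟨γ, hγ, hle⟩ := (isClubIn_iff.1 hE).2.1 b hb
    exact (hEb ⟨γ, hγ⟩).not_ge hle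
  obtain ⟨E', hE', hmk⟩ := le_mk_iff_exists_subset.1 hcard
  obtain ⟨b, hb, hEb⟩ := exists_bound hκ (hmk.trans_lt (Cardinal.lift_lt.2 hlam))
    (fun x : E' => g x.1) fun x => (hg _ (hE' x.2).1).1
  obtain ⟨α, hα, hle⟩ := h.unbounded b hb
  obtain ⟨D, hD⟩ := h.pruned_nonempty hκ hα
  -- Fix D on a level above λ many closure points; at each c a pruned node branches off D between c
  -- and `g c`. These λ nodes are distinct, too many for a pruned level.
  have hF : ∀ c : E', ∃ F ∈ pruned A T α, F ∩ Set.Iio c.1 = D ∩ Set.Iio c.1 ∧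
      F ∩ Set.Iio (g c.1) ≠ D ∩ Set.Iio (g c.1) := by
    intro c
    obtain ⟨-, γ, hγ, hcγ, hγg, hs⟩ := hg c.1 (hE' c.2).1
    have hgα : g c.1 < α := (hEb c).trans_le hle
    obtain ⟨β, hβ, hγβ, hβg, D₁, hD₁, D₂, hD₂, h1, h2, hne⟩ :=
      hs _ (h.pruned_restrict hα hγ (hγg.trans hgα) hD)
    have : ∃ D' ∈ pruned A T β, D' ∩ Set.Iio γ = D ∩ Set.Iio γ ∧ D' ≠ D ∩ Set.Iio β := by
      by_cases hD : D₁ = D ∩ Set.Iio β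
      · exact ⟨D₂, hD₂, h2, fun h => hne (hD.trans h.symm)⟩
      · exact ⟨D₁, hD₁, h1, hD⟩
    obtain ⟨D', hD', hr, hne'⟩ := this
    obtain ⟨F, hF, rfl⟩ := h.pruned_extend hκ hα (hβg.trans hgα) hD'
    refine ⟨F, hF, ?_, fun heq => hne' ?_⟩
    · rw [inter_Iio_inter_Iio_of_le F hγβ.le] at hr
      rw [← inter_Iio_inter_Iio_of_le F hcγ, hr, inter_Iio_inter_Iio_of_le D hcγ]
    · rw [← inter_Iio_inter_Iio_of_le F hβg.le, heq, inter_Iio_inter_Iio_of_le D hβg.le]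
  choose F hF1 hF2 hF3 using hF
  have hne : ∀ c d : E', c.1 < d.1 → F c ≠ F d := by
    intro c d hcd heq
    have hgd : g c.1 < d.1 := (hE' d.2).2.2 _ hcd
    apply hF3 c
    rw [heq, ← inter_Iio_inter_Iio_of_le (F d) hgd.le, hF2 d, inter_Iio_inter_Iio_of_le D hgd.le]
  have hinj : Function.Injective fun c => (⟨F c, hF1 c⟩ : pruned A T α) := by
    intro c d hcd
    have hcd : F c = F d := congrArg Subtype.val hcd
    rcases lt_trichotomy c.1 d.1 with hlt | heq | hlt
    · exact absurd hcd (hne c d hlt)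
    · exact Subtype.ext heq
    · exact absurd hcd.symm (hne d c hlt)
  exact ((mk_le_of_injective hinj).trans_lt (h.mk_pruned_lt hκ hlev hα)).ne hmk

end IsSetTree

/-! ### From absorption of a club to a thread -/

section

variable {κ : Cardinal.{u}} {𝒞 : Ordinal.{u} → Set (Set Ordinal.{u})} {E : Set Ordinal.{u}}

/-- The members of `𝒞 γ` containing all points of `E` strictly between `ε` and `γ`. -/
def absorbing (𝒞 : Ordinal.{u} → Set (Set Ordinal.{u})) (E : Set Ordinal.{u})
    (ε γ : Ordinal.{u}) : Set (Set Ordinal.{u}) :=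
  {C | C ∈ 𝒞 γ ∧ E ∩ Set.Ioo ε γ ⊆ C}

theorem isLim_of_absorbing {ε α γ : Ordinal.{u}} {C : Set Ordinal.{u}} (hl : IsLim E γ)
    (hε : ε < γ) (hγα : γ ≤ α) (hC : C ∈ absorbing 𝒞 E ε α) : IsLim C γ := by
  refine ⟨hl.1, fun ξ hξ => ?_⟩
  obtain ⟨η, hη, h1, h2⟩ := hl.2 (max ξ ε) (max_lt hξ hε)
  exact ⟨η, hC.2 ⟨hη, (le_max_right _ _).trans_lt h1, h2.trans_le hγα⟩,
    (le_max_left _ _).trans_lt h1, h2⟩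

theorem absorbing_restrict (hcoh : IsCoherentClubSeq κ κ 𝒞) {ε α γ : Ordinal.{u}}
    {C : Set Ordinal.{u}} (hα : α < κ.ord) (hlα : IsLim E α) (hl : IsLim E γ)
    (hε : ε < γ) (hγα : γ < α) (hC : C ∈ absorbing 𝒞 E ε α) :
    C ∩ Set.Iio γ ∈ absorbing 𝒞 E ε γ := by
  obtain ⟨⟨-, hclub, -⟩, hc⟩ := hcoh α hα hlα.isSuccLimit
  have hlC := isLim_of_absorbing hl hε hγα.le hC
  have hmem := (isClubIn_iff.1 (hclub C hC.1)).2.2 γ hγα hlC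
  exact ⟨hc C hC.1 γ (mem_acc_iff.2 ⟨hmem, hlC⟩),
    fun x hx => ⟨hC.2 ⟨hx.1, hx.2.1, hx.2.2.trans hγα⟩, hx.2.2⟩⟩

/-- If the members of `𝒞` at stationarily many small levels absorb final segments of a club, then
`𝒞` has a thread. -/
theorem exists_thread_of_absorbing (hκ : κ.IsRegular) (hunc : ℵ₀ < κ) {lam : Cardinal.{u}}
    (hlam : lam < κ) (hcoh : IsCoherentClubSeq κ κ 𝒞) {S : Set Ordinal.{u}}
    (hst : IsStationaryIn S κ.ord) (hS : ∀ α ∈ S, #(𝒞 α) < Cardinal.lift.{u + 1} lam)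
    (hE : IsClubIn E κ.ord)
    (habs : ∀ α ∈ S, α < κ.ord → IsLim E α → ∃ ε < α, (absorbing 𝒞 E ε α).Nonempty) :
    ∃ U, IsClubIn U κ.ord ∧ ∀ β ∈ acc U, U ∩ Set.Iio β ∈ 𝒞 β := by
  have hlim : Order.IsSuccLimit κ.ord := Cardinal.isSuccLimit_ord hκ.aleph0_le
  have hnext : ∀ ξ, ∃ η, ξ < κ.ord → η ∈ E ∧ ξ < η ∧ η < κ.ord := by
    intro ξ
    by_cases hξ : ξ < κ.ord
    · obtain ⟨η, h⟩ := hE.exists_gt hlim hξ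
      exact ⟨η, fun _ => h⟩
    · exact ⟨0, fun h => absurd h hξ⟩
  choose n hn using hnext
  have hclosed : ∀ f : Ordinal.{u} → Ordinal.{u}, (∀ ξ < κ.ord, f ξ < κ.ord) →
      ∃ α ∈ S, α < κ.ord ∧ IsLim E α ∧ ∀ ξ < α, f ξ < α := by
    intro f hf
    obtain ⟨α, hα, h1, h2, h3⟩ := hst.exists_closed hκ hunc (g := fun ξ => max (n ξ) (f ξ))
      fun ξ hξ => max_lt (hn ξ hξ).2.2 (hf ξ hξ)
    refine ⟨α, hα, h1, ⟨h2, fun ξ hξ => ?_⟩, fun ξ hξ => (le_max_right _ _).trans_lt (h3 ξ hξ)⟩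
    obtain ⟨h4, h5, -⟩ := hn ξ (hξ.trans h1)
    exact ⟨n ξ, h4, h5, (le_max_left _ _).trans_lt (h3 ξ hξ)⟩
  -- Pressing down by hand: if each ε worked only boundedly often, a point of S closed under these
  -- bounds would have no ε.
  obtain ⟨ε, hεκ, hε⟩ : ∃ ε < κ.ord, ∀ ξ < κ.ord, ∃ α ∈ S, α < κ.ord ∧ ξ ≤ α ∧ IsLim E α ∧
      ε < α ∧ (absorbing 𝒞 E ε α).Nonempty := by
    by_contra! hcon
    have hf : ∀ ε, ∃ ξ, ε < κ.ord → ξ < κ.ord ∧ ∀ α ∈ S, α < κ.ord → ξ ≤ α → IsLim E α →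
        ε < α → absorbing 𝒞 E ε α = ∅ := by
      intro ε
      by_cases hε : ε < κ.ord
      · obtain ⟨ξ, h⟩ := hcon ε hε
        exact ⟨ξ, fun _ => h⟩
      · exact ⟨0, fun h => absurd h hε⟩
    choose f hf using hf
    obtain ⟨α, hαS, hα, hl, hfα⟩ := hclosed f fun ξ hξ => (hf ξ hξ).1
    obtain ⟨ε, hε, hne⟩ := habs α hαS hα hl
    exact hne.ne_empty ((hf ε (hε.trans hα)).2 α hαS hα (hfα ε hε).le hl hε)
  have htree : IsSetTree κ {γ | γ < κ.ord ∧ ε < γ ∧ IsLim E γ} (absorbing 𝒞 E ε) := by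
    refine ⟨fun γ hγ => hγ.1, fun ξ hξ => ?_, ?_, ?_, ?_, ?_⟩
    · obtain ⟨α, -, h1, h2, h3, h4, -⟩ := hε ξ hξ
      exact ⟨α, ⟨h1, h4, h3⟩, h2⟩
    · rintro γ ⟨hγ, -, hl⟩ C hC
      exact ((hcoh γ hγ hl.isSuccLimit).1.2.1 C hC.1).1
    · rintro α ⟨hα, -, hlα⟩ γ ⟨-, hεγ, hl⟩ hγα C hC
      exact absorbing_restrict hcoh hα hlα hl hεγ hγα hC
    · rintro γ ⟨hγ, -, hl⟩
      exact (mk_le_mk_of_subset fun C hC => hC.1).trans_lt (hcoh γ hγ hl.isSuccLimit).1.2.2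
    · rintro γ ⟨hγ, hεγ, hl⟩
      obtain ⟨α, -, h1, h2, h3, -, C, hC⟩ := hε _ (hlim.succ_lt hγ)
      exact ⟨_, absorbing_restrict hcoh h1 h3 hl hεγ (Order.succ_le_iff.1 h2) hC⟩
  obtain ⟨U, hU, hUT⟩ := htree.exists_branch hκ hunc hlam fun ξ hξ => by
    obtain ⟨α, hαS, h1, h2, h3, h4, -⟩ := hε ξ hξ
    exact ⟨α, ⟨h1, h4, h3⟩, h2, (mk_le_mk_of_subset fun C hC => hC.1).trans_lt (hS α hαS)⟩
  have htop : ∀ ξ < κ.ord, ∃ α < κ.ord, ξ < α ∧ Order.IsSuccLimit α ∧ U ∩ Set.Iio α ∈ 𝒞 α := by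
    intro ξ hξ
    obtain ⟨α, hα, h2⟩ := htree.unbounded _ (hlim.succ_lt hξ)
    exact ⟨α, hα.1, Order.succ_le_iff.1 h2, hα.2.2.isSuccLimit, (hUT α hα).1⟩
  refine ⟨U, isClubIn_iff.2 ⟨hU, fun ξ hξ => ?_, fun β hβ hl => ?_⟩, fun β hβ => ?_⟩
  · obtain ⟨α, hα, h1, h2, h3⟩ := htop ξ hξ
    obtain ⟨γ, h4, h5⟩ := (isClubIn_iff.1 ((hcoh α hα h2).1.2.1 _ h3)).2.1 ξ h1
    exact ⟨γ, h4.1, h5⟩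
  · obtain ⟨α, hα, h1, h2, h3⟩ := htop β hβ
    exact ((isClubIn_iff.1 ((hcoh α hα h2).1.2.1 _ h3)).2.2 β h1
      ((isLim_inter_Iio h1.le).2 hl)).1
  · obtain ⟨hβU, hl⟩ := mem_acc_iff.1 hβ
    obtain ⟨α, hα, h1, h2, h3⟩ := htop β (hU hβU)
    rw [← inter_Iio_inter_Iio_of_le U h1.le]
    exact (hcoh α hα h2).2 _ h3 β
      (mem_acc_iff.2 ⟨⟨hβU, h1⟩, (isLim_inter_Iio h1.le).2 hl⟩)

/-- A `□(κ, <κ)`-sequence with stationarily many small levels has, for every `e : κ → κ`, a level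
in this stationary set all of whose members have cofinally many non-accumulation points `β` with
`e (sup (C ∩ β)) ≤ β`. -/
theorem IsSquareLTSeq.exists_large_gaps (hκ : κ.IsRegular) (hunc : ℵ₀ < κ) {lam : Cardinal.{u}}
    (hlam : lam < κ) (hsq : IsSquareLTSeq κ κ 𝒞) {S : Set Ordinal.{u}}
    (hst : IsStationaryIn S κ.ord) (hS : ∀ α ∈ S, #(𝒞 α) < Cardinal.lift.{u + 1} lam)
    {e : Ordinal.{u} → Ordinal.{u}} (he : ∀ ξ < κ.ord, e ξ < κ.ord) :
    ∃ α ∈ S, α < κ.ord ∧ Order.IsSuccLimit α ∧ ∀ C ∈ 𝒞 α, ∀ ε < α, ∃ β ∈ nacc C,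
      ε ≤ sSup (C ∩ Set.Iio β) ∧ e (sSup (C ∩ Set.Iio β)) ≤ β := by
  by_contra! hcon
  obtain ⟨U, hU, hthread⟩ := exists_thread_of_absorbing hκ hunc hlam hsq.1 hst hS
    (isClubIn_closurePoints hκ hunc he) (fun α hαS hα hl => by
      obtain ⟨C, hC, ε, hε, hgap⟩ := hcon α hαS hα hl.isSuccLimit
      have hclub := (hsq.1 α hα hl.isSuccLimit).1.2.1 C hC
      -- A point c of C above ε makes every gap of C beyond c subject to `hgap`.
      obtain ⟨c, hc, hεc, hcα⟩ := hclub.exists_gt hl.isSuccLimit hε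
      refine ⟨c, hcα, C, hC, ?_⟩
      rintro η ⟨hη, hcη, hηα⟩
      by_contra hηC
      obtain ⟨γ, hγC, hηγ⟩ := (isClubIn_iff.1 hclub).2.1 η hηα
      -- The least point of C above a missed η ends the gap around η. If the gap starts below η,
      -- closure of η under `e` makes it long; if it starts at η, then η is a limit of C and so
      -- belongs to C.
      obtain ⟨β, ⟨hβC, hηβ⟩, hmin⟩ := WellFounded.has_min Ordinal.lt_wf (C ∩ Set.Ici η)
        ⟨γ, hγC, hηγ⟩
      have hηβ : η < β := lt_of_le_of_ne hηβ fun h => hηC (h ▸ hβC)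
      have hβl : ¬ IsLim C β := fun hl => by
        obtain ⟨ζ, h1, h2, h3⟩ := hl.2 η hηβ
        exact hmin ζ ⟨h1, h2.le⟩ h3
      have hle : sSup (C ∩ Set.Iio β) ≤ η := csSup_le' fun ζ hζ => by
        by_contra! hlt
        exact hmin ζ ⟨hζ.1, hlt.le⟩ hζ.2
      rcases hle.lt_or_eq with hlt | heq
      · exact (hgap β (mem_nacc_iff.2 ⟨hβC, hβl⟩)
          (hεc.le.trans (le_sSup_inter_Iio hc (hcη.trans hηβ)))).not_gt
          ((hη.2.2 _ hlt).trans hηβ)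
      · refine hηC ((isClubIn_iff.1 hclub).2.2 η hηα ⟨hη.2.1, fun ξ hξ => ?_⟩)
        rw [← heq] at hξ
        obtain ⟨ζ, hζ, hξζ⟩ := exists_lt_of_lt_csSup' hξ
        have : ζ ≤ η := heq ▸ le_sSup_inter_Iio hζ.1 hζ.2
        exact ⟨ζ, hζ.1, hξζ, lt_of_le_of_ne this fun h => hηC (h ▸ hζ.1)⟩)
  obtain ⟨α, hα, hnot⟩ := hsq.2 U hU
  exact hnot (hthread α hα)

end

/-! ### Enumerating guesses -/

theorem mk_Iio_ord (c : Cardinal.{u}) : #(Set.Iio c.ord) = Cardinal.lift.{u + 1} c := by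
  rw [Cardinal.mk_Iio_ordinal, Cardinal.card_ord]

theorem exists_enumeration {Q : Type (u + 1)} [Nonempty Q] {c : Cardinal.{u}}
    (h : #Q ≤ Cardinal.lift.{u + 1} c) : ∃ f : Ordinal.{u} → Q, ∀ q, ∃ ι < c.ord, f ι = q := by
  rw [← mk_Iio_ord] at h
  obtain ⟨j⟩ := h
  have hj : Function.Injective fun q => (j q).1 := Subtype.val_injective.comp j.injective
  exact ⟨Function.invFun fun q => (j q).1, fun q => ⟨(j q).1, (j q).2,
    Function.leftInverse_invFun hj q⟩⟩

theorem exists_enumeration_Iio {lam : Cardinal.{u}} {β : Ordinal.{u}}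
    (hβ : β < (Order.succ lam).ord) :
    ∃ f : Ordinal.{u} → Ordinal.{u}, ∀ ν < β, ∃ ι < lam.ord, f ι = ν := by
  rcases (Set.Iio β).eq_empty_or_nonempty with h0 | h0
  · exact ⟨id, fun ν hν => absurd (show ν ∈ Set.Iio β from hν) (by simp [h0])⟩
  · have := h0.to_subtype
    obtain ⟨f, hf⟩ := exists_enumeration (Q := Set.Iio β) (c := lam) (by
      rw [Cardinal.mk_Iio_ordinal, Cardinal.lift_le]
      exact Order.lt_succ_iff.1 (Cardinal.lt_ord.1 hβ))
    refine ⟨fun ι => (f ι).1, fun ν hν => ?_⟩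
    obtain ⟨ι, h1, h2⟩ := hf ⟨ν, hν⟩
    exact ⟨ι, h1, congrArg Subtype.val h2⟩

/-- If `2 ^ lam = lam⁺`, then the restrictions of `lam`-sequences of sets of ordinals to ordinals
below `lam⁺` can be enumerated in order type `lam⁺`. -/
theorem exists_guess {lam : Cardinal.{u}} (hinf : ℵ₀ ≤ lam)
    (hexp : (2 : Cardinal.{u}) ^ lam = Order.succ lam) :
    ∃ G : Ordinal.{u} → Ordinal.{u} × (Ordinal.{u} → Set Ordinal.{u}),
      ∀ (X : Ordinal.{u} → Set Ordinal.{u}), ∀ ξ < (Order.succ lam).ord,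
        ∃ ν < (Order.succ lam).ord, (G ν).1 = ξ ∧
          ∀ k < lam.ord, (G ν).2 k ∩ Set.Iio ξ = X k ∩ Set.Iio ξ := by
  have hen : ∀ β : Ordinal.{u}, ∃ f : Ordinal.{u} → Ordinal.{u}, β < (Order.succ lam).ord →
      ∀ ν < β, ∃ ι < lam.ord, f ι = ν := by
    intro β
    by_cases hβ : β < (Order.succ lam).ord
    · obtain ⟨f, hf⟩ := exists_enumeration_Iio hβ
      exact ⟨f, fun _ => hf⟩
    · exact ⟨id, fun h => absurd h hβ⟩
  choose en hen using hen
  have hsucc : ℵ₀ ≤ Order.succ lam := hinf.trans (Order.le_succ lam)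
  have hpos : (0 : Ordinal.{u}) < (Order.succ lam).ord :=
    (Cardinal.isSuccLimit_ord hsucc).bot_lt
  have : Nonempty (Set.Iio (Order.succ lam).ord) := ⟨⟨0, hpos⟩⟩
  obtain ⟨f, hf⟩ := exists_enumeration
    (Q := Set.Iio (Order.succ lam).ord × Set (Set.Iio lam.ord × Set.Iio lam.ord))
    (c := Order.succ lam) (by
      rw [Cardinal.mk_prod, Cardinal.mk_set, Cardinal.mk_prod, mk_Iio_ord, mk_Iio_ord]
      simp only [Cardinal.lift_id]
      rw [← Cardinal.lift_mul, Cardinal.mul_eq_self hinf, ← Cardinal.lift_two_power, hexp,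
        ← Cardinal.lift_mul, Cardinal.mul_eq_self hsucc])
  refine ⟨fun ν => ((f ν).1.1, fun k => {x | ∃ (h : k < lam.ord) (ι : Set.Iio lam.ord),
    en (f ν).1.1 ι.1 = x ∧ (⟨⟨k, h⟩, ι⟩ : Set.Iio lam.ord × Set.Iio lam.ord) ∈ (f ν).2}),
    fun X ξ hξ => ?_⟩
  -- Via the enumeration of ξ in type λ, the restricted sequence is coded by a subset of λ × λ.
  obtain ⟨ν, hν, hfν⟩ := hf (⟨ξ, hξ⟩, {q | en ξ q.2.1 ∈ X q.1.1})
  refine ⟨ν, hν, by simp only [hfν], fun k hk => ?_⟩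
  simp only [hfν]
  ext x
  constructor
  · rintro ⟨⟨_, ι, rfl, h⟩, hx⟩
    exact ⟨h, hx⟩
  · rintro ⟨h, hx⟩
    obtain ⟨ι, hι, rfl⟩ := hen ξ hξ x hx
    exact ⟨⟨hk, ⟨ι, hι⟩, rfl, h⟩, hx⟩

/-- Construction of a sequence by recursion along its truncations. -/
theorem exists_eq_truncation {B : Type*} (d : B) (F : Ordinal.{u} → (Ordinal.{u} → B) → B) :
    ∃ X : Ordinal.{u} → B, ∀ i, X i = F i (open Classical in fun k => if k < i then X k else d) := by
  classical
  refine ⟨Ordinal.lt_wf.fix fun i ih => F i fun k => if h : k < i then ih k h else d, fun i => ?_⟩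
  rw [WellFounded.fix_eq]
  congr 1

/-! ### Predicting the next set from the earlier ones -/

section predict

variable (lam : Cardinal.{u}) (G : Ordinal.{u} → Ordinal.{u} × (Ordinal.{u} → Set Ordinal.{u}))
  (en : Ordinal.{u} → Ordinal.{u} → Ordinal.{u}) (X : Ordinal.{u} → Set Ordinal.{u})
  (i δ β : Ordinal.{u})

/-- The guess `G ν` lies below `β`, all its sets have elements above `δ`, and its first `i` sets
agree with those of `X`. -/
def Fits (ν : Ordinal.{u}) : Prop :=
  (G ν).1 ≤ β ∧ (∀ k < lam.ord, ∃ y ∈ (G ν).2 k, δ < y ∧ y < (G ν).1) ∧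
    ∀ k < i, (G ν).2 k ∩ Set.Iio (G ν).1 = X k ∩ Set.Iio (G ν).1

/-- The elements above `δ` of the `i`-th set in the first fitting guess. -/
def predictions : Set Ordinal.{u} :=
  {y | ∃ ι, IsLeast {ι | Fits lam G X i δ β (en β ι)} ι ∧ y ∈ (G (en β ι)).2 i ∧ δ < y ∧
    y < (G (en β ι)).1}

open Classical in
/-- The least predicted element of the `i`-th set between `δ` and `β`. -/
noncomputable def predict : Ordinal.{u} :=
  if (predictions lam G en X i δ β).Nonempty then sInf (predictions lam G en X i δ β) else β

variable {lam G en X i δ β}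

theorem predict_mem_predictions (h : (predictions lam G en X i δ β).Nonempty) :
    predict lam G en X i δ β ∈ predictions lam G en X i δ β := by
  rw [predict, if_pos h]
  exact csInf_mem h

theorem isSelector_predict : IsSelector (predict lam G en X i) := by
  intro δ β
  by_cases h : (predictions lam G en X i δ β).Nonempty
  · obtain ⟨ι, h1, -, h2, h3⟩ := predict_mem_predictions h
    exact ⟨h3.le.trans h1.1.1, fun _ => h2⟩
  · rw [predict, if_neg h]
    exact ⟨le_rfl, id⟩

/-- This is what makes the recursion defining X legitimate. -/
theorem predict_congr {Y : Ordinal.{u} → Set Ordinal.{u}} (h : ∀ k < i, X k = Y k) :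
    predict lam G en X i = predict lam G en Y i := by
  have hfits : Fits lam G X i = Fits lam G Y i := by
    funext δ β ν
    refine propext (and_congr_right fun _ => and_congr_right fun _ => forall₂_congr fun k hk => ?_)
    rw [h k hk]
  unfold predict predictions
  rw [hfits]

/-- If some guess enumerated below `lam` agrees with all of `X`, then the predictions are
correct from some stage on. -/
theorem exists_forall_predict_mem (hreg : lam.IsRegular) {ι : Ordinal.{u}} (hι : ι < lam.ord)
    (hfit : Fits lam G X lam.ord δ β (en β ι)) :
    ∃ j < lam.ord, ∀ i < lam.ord, j ≤ i → predict lam G en X i δ β ∈ X i := by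
  have hlim : Order.IsSuccLimit lam.ord := Cardinal.isSuccLimit_ord hreg.aleph0_le
  -- Each guess is right throughout or has a stage `k η` refuting it.
  have hk : ∀ η, ∃ k < lam.ord, (∀ l < lam.ord, (G (en β η)).2 l ∩ Set.Iio (G (en β η)).1 =
      X l ∩ Set.Iio (G (en β η)).1) ∨ (G (en β η)).2 k ∩ Set.Iio (G (en β η)).1 ≠
      X k ∩ Set.Iio (G (en β η)).1 := by
    intro η
    by_cases h : ∀ l < lam.ord, (G (en β η)).2 l ∩ Set.Iio (G (en β η)).1 =
      X l ∩ Set.Iio (G (en β η)).1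
    · exact ⟨0, hlim.bot_lt, Or.inl h⟩
    · push Not at h
      obtain ⟨k, hk, hne⟩ := h
      exact ⟨k, hk, Or.inr hne⟩
  choose k hk1 hk2 using hk
  obtain ⟨j, hj, hkj⟩ := exists_bound_Iio hreg (hlim.succ_lt hι) k fun η _ => hk1 η
  refine ⟨j, hj, fun i hi hji => ?_⟩
  have hfit' : Fits lam G X i δ β (en β ι) :=
    ⟨hfit.1, hfit.2.1, fun k hk => hfit.2.2 k (hk.trans hi)⟩
  obtain ⟨η, hη⟩ : ∃ η, IsLeast {η | Fits lam G X i δ β (en β η)} η :=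
    ⟨_, csInf_mem ⟨ι, hfit'⟩, fun _ h => csInf_le' h⟩
  obtain ⟨y, hy1, hy2, hy3⟩ := hη.1.2.1 i hi
  obtain ⟨η', hη', h1, -, h2⟩ := predict_mem_predictions (lam := lam) (G := G) (en := en)
    ⟨y, η, hη, hy1, hy2, hy3⟩
  obtain rfl := hη.unique hη'
  -- The trusted index is at most ι, so a wrong guess there would already be refuted.
  have hlt : k η < j := hkj η (Order.lt_succ_iff.2 (hη.2 hfit'))
  have hagree : (G (en β η)).2 i ∩ Set.Iio (G (en β η)).1 = X i ∩ Set.Iio (G (en β η)).1 := by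
    rcases hk2 η with h | h
    · exact h i hi
    · exact absurd (hη.1.2.2 _ (hlt.trans_le hji)) h
  exact (hagree.subset ⟨h1, h2⟩).1

end predict

/-- For every `lam`-sequence of cofinal subsets of `lam⁺`, some guess fits in every sufficiently
long interval. -/
theorem exists_fits {lam : Cardinal.{u}} (hinf : ℵ₀ ≤ lam)
    {G : Ordinal.{u} → Ordinal.{u} × (Ordinal.{u} → Set Ordinal.{u})}
    (hG : ∀ (X : Ordinal.{u} → Set Ordinal.{u}), ∀ ξ < (Order.succ lam).ord,
        ∃ ν < (Order.succ lam).ord, (G ν).1 = ξ ∧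
          ∀ k < lam.ord, (G ν).2 k ∩ Set.Iio ξ = X k ∩ Set.Iio ξ)
    {X : Ordinal.{u} → Set Ordinal.{u}}
    (hX : ∀ k, X k ⊆ Set.Iio (Order.succ lam).ord)
    (hcof : ∀ k, ∀ ξ < (Order.succ lam).ord, ∃ y ∈ X k, ξ ≤ y)
    {δ : Ordinal.{u}} (hδ : δ < (Order.succ lam).ord) :
    ∃ b < (Order.succ lam).ord, δ < b ∧ ∀ β, b ≤ β →
      ∃ ν < β, Fits lam G X lam.ord δ β ν := by
  have hκ := Cardinal.isRegular_succ hinf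
  have hlim : Order.IsSuccLimit (Order.succ lam).ord := Cardinal.isSuccLimit_ord hκ.aleph0_le
  choose y hyX hy using fun k => hcof k _ (hlim.succ_lt hδ)
  obtain ⟨ξ, hξ, hyξ⟩ := exists_bound_Iio hκ (Cardinal.ord_lt_ord.2 (Order.lt_succ lam)) y
    fun k _ => hX k (hyX k)
  obtain ⟨ν, hν, h1, h2⟩ := hG X ξ hξ
  -- Beyond this bound the gap is nonempty, the guess ν is listed below β, and its height ξ is at
  -- most β.
  refine ⟨max (Order.succ δ) (max (Order.succ ν) ξ),
    max_lt (hlim.succ_lt hδ) (max_lt (hlim.succ_lt hν) hξ),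
    lt_max_of_lt_left (Order.lt_succ δ), fun β hβ => ?_⟩
  obtain ⟨-, hβ⟩ := max_le_iff.1 hβ
  obtain ⟨h3, h4⟩ := max_le_iff.1 hβ
  refine ⟨ν, Order.succ_le_iff.1 h3, h1.le.trans h4, fun k hk => ?_, fun k hk => ?_⟩
  · rw [h1]
    exact ⟨y k, ((h2 k hk).symm.subset ⟨hyX k, hyξ k hk⟩).1, Order.succ_le_iff.1 (hy k), hyξ k hk⟩
  · rw [h1, h2 k hk]

/-! ### The diagonal argument -/

theorem mem_acc_Iio {κ α : Ordinal.{u}} (hα : α < κ) (hlim : Order.IsSuccLimit α) :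
    α ∈ acc (Set.Iio κ) :=
  mem_acc_iff.2 ⟨hα, hlim.bot_lt, fun ξ hξ =>
    ⟨Order.succ ξ, (hlim.succ_lt hξ).trans hα, Order.lt_succ ξ, hlim.succ_lt hξ⟩⟩

/-- `⊠*(lam⁺)` follows from `2 ^ lam = lam⁺` and a `□(lam⁺, lam)`-sequence with stationarily many
small levels of small cofinality. -/
theorem boxTimesStar_of_isSquareSeq {lam : Cardinal.{u}} (hreg : lam.IsRegular)
    (hexp : (2 : Cardinal.{u}) ^ lam = Order.succ lam)
    {𝒞 : Ordinal.{u} → Set (Set Ordinal.{u})} (hsq : IsSquareSeq (Order.succ lam) lam 𝒞)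
    (hst : IsStationaryIn
      {α | α ∈ cofBelow (Order.succ lam) lam ∧ #(𝒞 α) < Cardinal.lift.{u + 1} lam}
      (Order.succ lam).ord) :
    BoxTimesStar (Order.succ lam) := by
  classical
  have hinf := hreg.aleph0_le
  have hκ := Cardinal.isRegular_succ hinf
  have hlt : lam < Order.succ lam := Order.lt_succ lam
  obtain ⟨G, hG⟩ := exists_guess hinf hexp
  have hen : ∀ β : Ordinal.{u}, ∃ f : Ordinal.{u} → Ordinal.{u}, β < (Order.succ lam).ord →
      ∀ ν < β, ∃ ι < lam.ord, f ι = ν := by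
    intro β
    by_cases hβ : β < (Order.succ lam).ord
    · obtain ⟨f, hf⟩ := exists_enumeration_Iio hβ
      exact ⟨f, fun _ => hf⟩
    · exact ⟨id, fun h => absurd h hβ⟩
  choose en hen using hen
  by_contra hno
  have hbad : ∀ p, ∃ Y ⊆ Set.Iio (Order.succ lam).ord,
      (∀ β < (Order.succ lam).ord, ∃ ξ ∈ Y, β ≤ ξ) ∧ (IsSelector p →
        ∀ α ∈ acc (Set.Iio (Order.succ lam).ord), ∃ C ∈ 𝒞 α,
          sSup (nacc (shift p C '' C) ∩ Y) ≠ α) := by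
    intro p
    by_cases hp : IsSelector p
    · by_contra! hcon
      refine hno ⟨_, hsq.1.shift hp, fun Y hY hcof => ?_⟩
      obtain ⟨-, α, hα, h⟩ := hcon Y hY hcof
      refine ⟨α, hα, ?_⟩
      rintro _ ⟨C, hC, rfl⟩
      exact h C hC
    -- For a non-selector any cofinal set will do; this keeps all X_k cofinal.
    · exact ⟨_, subset_rfl, fun β hβ => ⟨β, hβ, le_rfl⟩, fun h => absurd h hp⟩
  choose bad hbad1 hbad2 hbad3 using hbad
  obtain ⟨X, hXrec⟩ := exists_eq_truncation (∅ : Set Ordinal.{u})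
    fun i H => bad (predict lam G en H i)
  have hX : ∀ i, X i = bad (predict lam G en X i) := fun i => by
    rw [hXrec i]
    exact congrArg bad (predict_congr fun k hk => if_pos hk)
  have hXsub : ∀ k, X k ⊆ Set.Iio (Order.succ lam).ord := fun k => hX k ▸ hbad1 _
  have hXcof : ∀ k, ∀ ξ < (Order.succ lam).ord, ∃ y ∈ X k, ξ ≤ y := fun k => hX k ▸ hbad2 _
  have he : ∀ δ : Ordinal.{u}, ∃ b, δ < (Order.succ lam).ord → b < (Order.succ lam).ord ∧ δ < b ∧
      ∀ β, b ≤ β → ∃ ν < β, Fits lam G X lam.ord δ β ν := by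
    intro δ
    by_cases hδ : δ < (Order.succ lam).ord
    · obtain ⟨b, hb⟩ := exists_fits hinf hG hXsub hXcof hδ
      exact ⟨b, fun _ => hb⟩
    · exact ⟨0, fun h => absurd h hδ⟩
  choose e he using he
  obtain ⟨α, ⟨⟨-, hcof⟩, hsmall⟩, hα, hlim, hgap⟩ := IsSquareLTSeq.exists_large_gaps hκ
    (hinf.trans_lt hlt) hlt hsq hst (fun α hα => hα.2) fun ξ hξ => (he ξ hξ).1
  obtain ⟨s, hs, hmk⟩ := Order.exists_cof_eq (Set.Iio α)
  rw [Ordinal.cof_Iio, ← Ordinal.lift_cof] at hmk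
  have hstage : ∀ q : 𝒞 α × s, ∃ j < lam.ord, ∀ i < lam.ord, j ≤ i →
      ∃ y ∈ nacc (shift (predict lam G en X i) q.1.1 '' q.1.1) ∩ X i, q.2.1.1 < y := by
    rintro ⟨⟨C, hC⟩, ⟨a, ha⟩, has⟩
    obtain ⟨β, hβ, haβ, heβ⟩ := hgap C hC a ha
    have hβα : β < α := ((hsq.1 α hα hlim).1.2.1 C hC).1 hβ.1
    have hβκ : β < (Order.succ lam).ord := hβα.trans hα
    obtain ⟨-, hδe, hfit⟩ := he _ ((sSup_inter_Iio_le C β).trans_lt hβκ)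
    have hδβ := hδe.trans_le heβ
    obtain ⟨ν, hν, hfitν⟩ := hfit β heβ
    obtain ⟨ι, hι, rfl⟩ := hen β hβκ ν hν
    obtain ⟨j, hj, hpred⟩ := exists_forall_predict_mem hreg hι hfitν
    refine ⟨j, hj, fun i hi hji => ⟨shift (predict lam G en X i) C β,
      ⟨shift_mem_nacc isSelector_predict hβ, ?_⟩, ?_⟩⟩
    · rw [shift_of_not_isLim (mem_nacc_iff.1 hβ).2]
      exact hpred i hi hji
    · rw [shift_of_not_isLim (mem_nacc_iff.1 hβ).2]
      exact haβ.trans_lt ((isSelector_predict _ _).2 hδβ)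
  choose j hj hhit using hstage
  -- The level and the cofinality of α both have size below λ, so the stages `j q` have a common
  -- bound i < λ.
  obtain ⟨i, hi, hji⟩ := exists_bound hreg (by
    rw [Cardinal.mk_prod, Cardinal.lift_id, Cardinal.lift_id, hmk]
    exact Cardinal.mul_lt_of_lt (by simpa using hinf) hsmall (Cardinal.lift_lt.2 hcof)) j hj
  have hmem := mem_acc_Iio hα hlim
  obtain ⟨C, hC, hne⟩ := hbad3 _ (isSelector_predict (lam := lam) (G := G) (en := en)
    (X := X) (i := i)) α hmem
  rw [← hX i] at hne
  have hub : ∀ y ∈ nacc (shift (predict lam G en X i) C '' C) ∩ X i, y ≤ α := fun y hy =>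
    le_of_lt ((isClubIn_image_shift isSelector_predict hlim
      ((hsq.1 α hα hlim).1.2.1 C hC)).1 hy.1.1)
  refine hne (le_antisymm (csSup_le' hub) (le_of_forall_lt fun ξ hξ => ?_))
  obtain ⟨a, has, hξa⟩ := hs ⟨ξ, hξ⟩
  obtain ⟨y, hy, hay⟩ := hhit (⟨C, hC⟩, ⟨a, has⟩) i hi (hji _).le
  have hξy : ξ < y := lt_of_le_of_lt (show ξ ≤ a.1 from hξa) hay
  exact hξy.trans_le (le_csSup ⟨α, hub⟩ hy)

end SquareBox

theorem theorem2p4 (lam : Cardinal.{u}) (hreg : lam.IsRegular) (hunc : ℵ₀ < lam)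
    (hpow : lam ^< lam = lam) (hexp : (2 : Cardinal.{u}) ^ lam = Order.succ lam)
    (hsq : ∃ 𝒞 : Ordinal.{u} → Set (Set Ordinal.{u}),
      SquareBox.IsSquareSeq (Order.succ lam) lam 𝒞 ∧
      SquareBox.IsStationaryIn
        {α | α ∈ SquareBox.cofBelow (Order.succ lam) lam ∧ #(𝒞 α) < Cardinal.lift.{u + 1} lam}
        (Order.succ lam).ord) :
    SquareBox.BoxTimesStar (Order.succ lam) := by
  obtain ⟨𝒞, h1, h2⟩ := hsq
  exact SquareBox.boxTimesStar_of_isSquareSeq hreg hexp h1 h2
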